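/- **Setting.** Let $N$ be a number of stages, let $\Xi=\Xi_1\times\cdots\times\Xi_N$ be a finite set of scenarios $\xi=(\xi_1,\dots,\xi_N)$ with probabilities $p(\xi)>0$ that add up to $1$, let $J=|\Xi|$, $n=n_1+\cdots+n_N$ and $\bar n=nJ$. Let $\mathcal L_n$ be the Hilbert space of all maps $x:\Xi\to\mathbb R^n$, $x(\xi)=(x_1(\xi),\dots,x_N(\xi))$ with $x_k(\xi)\in\mathbb R^{n_k}$, with inner product $\langle x,w\rangle=\sum_{\xi}p(\xi)\sum_{k}\langle x_k(\xi),w_k(\xi)\rangle$. Let $\mathcal N_n\subset\mathcal L_n$ be the subspace of those $x$ for which every $x_k(\xi)$ does not depend on $\xi_k,\dots,\xi_N$, and let $$\mathcal M_n=\{w\in\mathcal L_n:\ E_{\xi|\xi_1,\dots,\xi_{k-1}}w_k(\xi)=0,\ k=1,\dots,N\}$$ be its orthogonal complement. For each $\xi$ let $C(\xi)\subset\mathbb R^n$ be nonempty, closed and convex, and let $\mathcal C=\{x\in\mathcal L_n: x(\xi)\in C(\xi)\ \forall\xi\}$. Let $\mathcal F$ be given by $\mathcal F(x)(\xi)=F(x(\xi),\xi)$,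 where $F(\cdot,\xi)$ maps $\mathbb R^n$ to $\mathbb R^n$. Let $\phi:\mathcal L_n\to\mathbb R^{\bar n}$ be the linear isometric isomorphism $\phi(x)=(\sqrt{p(\xi)}\,x(\xi))_{\xi\in\Xi}$, and let $\hat F:\mathbb R^{\bar n}\to\mathbb R^{\bar n}$, $\hat F(x)=\bigl(\sqrt{p(\xi)}\,F(x_\xi/\sqrt{p(\xi)},\xi)\bigr)_{\xi\in\Xi}$ for $x=(x_\xi)_{\xi\in\Xi}$, so that $\phi\circ\mathcal F=\hat F\circ\phi$. $P_V$ denotes the orthogonal projection onto a subspace $V$, and $N_{\mathcal C}(x)=\{v:\langle v,y-x\rangle\le 0\ \forall y\in\mathcal C\}$ for $x\in\mathcal C$, $N_{\mathcal C}(x)=\emptyset$ for $x\notin\mathcal C$, is the normal cone. A mapping $\mathcal F$ is *pseudomonotone* on a set $K$ if for all $x,y\in K$, $\langle y-x,\mathcal F(x)\rangle\ge 0$ implies $\langle y-x,\mathcal F(y)\rangle\ge 0$. A set-valued mapping $T:\mathcal L_n\rightrightarrows\mathcal L_n$ is *monotone* if $\langle u-v,x-y\rangle\ge0$ whenever $u\in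 T(x)$, $v\in T(y)$; it is *maximal monotone* if it is monotone and for every pair $(\hat x,\hat y)$ with $\hat y\notin T(\hat x)$ there are $\tilde x$ and $\tilde y\in T(\tilde x)$ with $\langle\hat y-\tilde y,\hat x-\tilde x\rangle<0$. The monotonicity of $\mathcal F+N_{\mathcal C}$ is *(globally) elicited at level $s>0$* (with respect to $\mathcal N_n$) if $\mathcal F+N_{\mathcal C}+sP_{\mathcal M_n}$ is maximal monotone. **Theorem.** Let $\mathcal C_0\supset\mathcal C$ be an open convex set in $\mathcal L_n$, and let $\mathcal F$ be continuously differentiable and pseudomonotone on $\mathcal C_0$. Assume that the Jacobian $D\hat F(x)$ is symmetric for every $x\in\phi(\mathcal C_0)$. If $e_2>0$ is such that, for every $x\in\phi(\mathcal C_0)$, the smallest eigenvalue of $D\hat F(x)+e_2P_{\phi(\mathcal M_n)}$ has multiplicity strictly larger than one, then the monotonicity of $\mathcal F+N_{\mathcal C}$ is globally elicited at every level $s\ge e_2$. -/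

import Mathlib

open scoped BigOperators

noncomputable section

/-! ### Set-valued monotone mappings, normal cones, pseudomonotonicity in a real Hilbert space -/

section Hilbert

variable {H : Type*} [NormedAddCommGroup H] [InnerProductSpace ℝ H]

/-- The single-valued mapping `F` is pseudomonotone on `K`. -/
def PseudomonotoneOn (F : H → H) (K : Set H) : Prop :=
  ∀ x ∈ K, ∀ y ∈ K, 0 ≤ inner ℝ (y - x) (F x) → 0 ≤ inner ℝ (y - x) (F y)

/-- The set-valued mapping `T : H ⇉ H` is monotone. -/
def IsMonotoneMap (T : H → Set H) : Prop :=
  ∀ x y : H, ∀ u ∈ T x, ∀ v ∈ T y, 0 ≤ inner ℝ (u - v) (x - y)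

/-- The set-valued mapping `T : H ⇉ H` is maximal monotone: it is monotone, and every pair outside
its graph fails to be monotonically related to some pair of the graph. -/
def IsMaximalMonotoneMap (T : H → Set H) : Prop :=
  IsMonotoneMap T ∧
    ∀ x y : H, y ∉ T x → ∃ x' y' : H, y' ∈ T x' ∧ inner ℝ (y - y') (x - x') < 0

/-- The normal cone of `C` at `x`; it is empty at points outside `C`. -/
def normalConeAt (C : Set H) (x : H) : Set H :=
  {v | x ∈ C ∧ ∀ y ∈ C, inner ℝ v (y - x) ≤ 0}

/-- The set-valued mapping `F + N_C + s P_M`, with `P_M` the orthogonal projection onto `M`. -/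
def elicitationMap (F : H → H) (C : Set H) (M : Submodule ℝ H) [M.HasOrthogonalProjection]
    (s : ℝ) (x : H) : Set H :=
  {z | ∃ v ∈ normalConeAt C x, z = F x + v + s • M.starProjection x}

/-- The monotonicity of `F + N_C` is elicited at level `s > 0` with respect to the subspace with
orthogonal complement `M`. -/
def IsElicitedAtLevel (F : H → H) (C : Set H) (M : Submodule ℝ H) [M.HasOrthogonalProjection]
    (s : ℝ) : Prop :=
  0 < s ∧ IsMaximalMonotoneMap (elicitationMap F C M s)

/-- The operator `A` has a smallest (real) eigenvalue, and the multiplicity of that eigenvalue is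
strictly larger than one. Used for symmetric operators on a finite-dimensional space, for which
algebraic and geometric multiplicity agree. -/
def HasMultipleMinEigenvalue (A : H →ₗ[ℝ] H) : Prop :=
  ∃ μ : ℝ, IsLeast {l : ℝ | Module.End.HasEigenvalue A l} μ ∧
    1 < Module.finrank ℝ (Module.End.eigenspace A μ)

end Hilbert

/-! ### The multistage stochastic setting -/

/-- Scenarios `ξ = (ξ_1, …, ξ_N)`: the sample space is the product of the stage supports. -/
abbrev Scenario {N : ℕ} (Ξ : Fin N → Type*) : Type _ := ∀ k, Ξ k

/-- A probability on the finite scenario space that charges every scenario. -/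
structure ScenarioLaw {N : ℕ} (Ξ : Fin N → Type*) [∀ k, Fintype (Ξ k)] where
  /-- the probability of a scenario -/
  prob : Scenario Ξ → ℝ
  prob_pos : ∀ ξ, 0 < prob ξ
  sum_prob : ∑ ξ, prob ξ = 1

/-- `ℝⁿ` with `n = n_1 + ⋯ + n_N`, coordinates grouped by stage. -/
abbrev DecisionSpace {N : ℕ} (d : Fin N → ℕ) : Type := EuclideanSpace ℝ ((k : Fin N) × Fin (d k))

/-- The stage-`k` part `x_k ∈ ℝ^{n_k}` of `x ∈ ℝⁿ`. -/
def stagePart {N : ℕ} {d : Fin N → ℕ} (k : Fin N) :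
    DecisionSpace d →ₗ[ℝ] EuclideanSpace ℝ (Fin (d k)) where
  toFun v := WithLp.toLp 2 fun i => v ⟨k, i⟩
  map_add' _ _ := rfl
  map_smul' _ _ := rfl

theorem stagePart_apply {N : ℕ} {d : Fin N → ℕ} (k : Fin N) (v : DecisionSpace d)
    (i : Fin (d k)) : stagePart k v i = v ⟨k, i⟩ := rfl

/-- The space `𝓛_n` of all mappings from scenarios to `ℝⁿ`. -/
def ResponseSpace {N : ℕ} {Ξ : Fin N → Type*} [∀ k, Fintype (Ξ k)] (_P : ScenarioLaw Ξ)
    (d : Fin N → ℕ) : Type _ :=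
  Scenario Ξ → DecisionSpace d

/-- The space `ℝ^{n̄}`, `n̄ = n J` with `J` the number of scenarios. -/
abbrev StackedSpace {N : ℕ} (Ξ : Fin N → Type*) [∀ k, Fintype (Ξ k)] (d : Fin N → ℕ) : Type _ :=
  EuclideanSpace ℝ (Scenario Ξ × ((k : Fin N) × Fin (d k)))

section Setting

variable {N : ℕ} {Ξ : Fin N → Type*} [∀ k, Fintype (Ξ k)]

theorem inner_decision_eq_sum {d : Fin N → ℕ} (v w : DecisionSpace d) :
    ∑ k, inner ℝ (stagePart k v) (stagePart k w) = inner ℝ v w := by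
  simp only [PiLp.inner_apply, Fintype.sum_sigma, stagePart_apply]

instance (P : ScenarioLaw Ξ) (d : Fin N → ℕ) : AddCommGroup (ResponseSpace P d) :=
  inferInstanceAs (AddCommGroup (Scenario Ξ → DecisionSpace d))

instance (P : ScenarioLaw Ξ) (d : Fin N → ℕ) : Module ℝ (ResponseSpace P d) :=
  inferInstanceAs (Module ℝ (Scenario Ξ → DecisionSpace d))

instance (P : ScenarioLaw Ξ) (d : Fin N → ℕ) : FiniteDimensional ℝ (ResponseSpace P d) :=
  inferInstanceAs (FiniteDimensional ℝ (Scenario Ξ → DecisionSpace d))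

/-- The inner product `⟨x, w⟩ = ∑_ξ p(ξ) ∑_k ⟨x_k(ξ), w_k(ξ)⟩` on `𝓛_n`. -/
@[reducible]
def responseInnerCore (P : ScenarioLaw Ξ) (d : Fin N → ℕ) :
    InnerProductSpace.Core ℝ (ResponseSpace P d) where
  inner x w := ∑ ξ, P.prob ξ * ∑ k, inner ℝ (stagePart k (x ξ)) (stagePart k (w ξ))
  conj_inner_symm x w := by
    simp [inner_decision_eq_sum, real_inner_comm]
  re_inner_nonneg x := by
    simp only [inner_decision_eq_sum]
    exact Finset.sum_nonneg fun ξ _ => mul_nonneg (P.prob_pos ξ).le real_inner_self_nonneg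
  add_left x y z := by
    simp only [inner_decision_eq_sum, ← Finset.sum_add_distrib, ← mul_add, ← inner_add_left]
    rfl
  smul_left x y r := by
    simp only [inner_decision_eq_sum, Finset.mul_sum]
    refine Finset.sum_congr rfl fun ξ _ => ?_
    change P.prob ξ * inner ℝ (r • x ξ) (y ξ) = _
    rw [real_inner_smul_left]
    simp only [conj_trivial]
    ring
  definite x hx := by
    simp only [inner_decision_eq_sum] at hx
    have hx := (Finset.sum_eq_zero_iff_of_nonneg
      (fun ξ _ => mul_nonneg (P.prob_pos ξ).le real_inner_self_nonneg)).1 hx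
    funext ξ
    have h := hx ξ (Finset.mem_univ ξ)
    rcases mul_eq_zero.1 h with h | h
    · exact absurd h (P.prob_pos ξ).ne'
    · exact inner_self_eq_zero.1 h

instance (P : ScenarioLaw Ξ) (d : Fin N → ℕ) : NormedAddCommGroup (ResponseSpace P d) :=
  (responseInnerCore P d).toNormedAddCommGroup

instance (P : ScenarioLaw Ξ) (d : Fin N → ℕ) : InnerProductSpace ℝ (ResponseSpace P d) :=
  InnerProductSpace.ofCore (responseInnerCore P d).toCore

theorem response_inner_def {P : ScenarioLaw Ξ} {d : Fin N → ℕ} (x w : ResponseSpace P d) :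
    inner ℝ x w = ∑ ξ, P.prob ξ * ∑ k, inner ℝ (stagePart k (x ξ)) (stagePart k (w ξ)) := rfl

/-- The nonanticipativity subspace `𝓝_n`: `x_k(ξ)` does not depend on `ξ_k, …, ξ_N`. -/
def nonanticipative (P : ScenarioLaw Ξ) (d : Fin N → ℕ) : Submodule ℝ (ResponseSpace P d) where
  carrier := {x | ∀ k, ∀ ξ η : Scenario Ξ, (∀ j < k, ξ j = η j) →
    stagePart k (x ξ) = stagePart k (x η)}
  zero_mem' _ _ _ _ := rfl
  add_mem' {x y} hx hy k ξ η h := by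
    change stagePart k (x ξ + y ξ) = stagePart k (x η + y η)
    rw [map_add, map_add, hx k ξ η h, hy k ξ η h]
  smul_mem' c x hx k ξ η h := by
    change stagePart k (c • x ξ) = stagePart k (c • x η)
    rw [map_smul, map_smul, hx k ξ η h]

open Classical in
/-- The conditional expectation `E_{ξ | ξ_1, …, ξ_{k-1}} g(ξ)`, as a function of the scenario. -/
def historyExpectation (P : ScenarioLaw Ξ) (k : Fin N) {E : Type*} [AddCommGroup E] [Module ℝ E]
    (g : Scenario Ξ → E) (ξ : Scenario Ξ) : E :=
  (∑ η with ∀ j < k, η j = ξ j, P.prob η)⁻¹ • ∑ η with ∀ j < k, η j = ξ j, P.prob η • g η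

open Classical in
theorem historyExpectation_eq_zero_iff (P : ScenarioLaw Ξ) (k : Fin N) {E : Type*}
    [AddCommGroup E] [Module ℝ E] (g : Scenario Ξ → E) (ξ : Scenario Ξ) :
    historyExpectation P k g ξ = 0 ↔ ∑ η with ∀ j < k, η j = ξ j, P.prob η • g η = 0 := by
  have h : 0 < ∑ η with ∀ j < k, η j = ξ j, P.prob η :=
    Finset.sum_pos (fun η _ => P.prob_pos η) ⟨ξ, by simp⟩
  rw [historyExpectation, smul_eq_zero_iff_right (inv_ne_zero h.ne')]

/-- The multiplier subspace `𝓜_n`: `E_{ξ | ξ_1, …, ξ_{k-1}} w_k(ξ) = 0` for every stage `k`. -/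
def multiplierSpace (P : ScenarioLaw Ξ) (d : Fin N → ℕ) : Submodule ℝ (ResponseSpace P d) where
  carrier := {w | ∀ k, ∀ ξ, historyExpectation P k (fun η => stagePart k (w η)) ξ = 0}
  zero_mem' k ξ := by
    have h : ∀ η, stagePart k ((0 : ResponseSpace P d) η) = 0 := fun η => map_zero _
    simp [historyExpectation, h]
  add_mem' {x y} hx hy k ξ := by
    have hx := (historyExpectation_eq_zero_iff P k _ ξ).1 (hx k ξ)
    have hy := (historyExpectation_eq_zero_iff P k _ ξ).1 (hy k ξ)
    rw [historyExpectation_eq_zero_iff]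
    have h : ∀ η, stagePart k ((x + y) η) = stagePart k (x η) + stagePart k (y η) :=
      fun η => map_add _ _ _
    simp only [h, smul_add, Finset.sum_add_distrib, hx, hy, add_zero]
  smul_mem' c x hx k ξ := by
    have hx := (historyExpectation_eq_zero_iff P k _ ξ).1 (hx k ξ)
    rw [historyExpectation_eq_zero_iff]
    have h : ∀ η, stagePart k ((c • x) η) = c • stagePart k (x η) := fun η => (stagePart k).map_smul c (x η)
    simp only [h, smul_comm _ c, ← Finset.smul_sum, hx, smul_zero]

/-- The multiplier subspace is the orthogonal complement of the nonanticipativity subspace. -/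
theorem multiplierSpace_eq_orthogonal (P : ScenarioLaw Ξ) (d : Fin N → ℕ) :
    multiplierSpace P d = (nonanticipative P d)ᗮ := by
  classical
  ext w
  rw [Submodule.mem_orthogonal]
  constructor
  · intro hw x hx
    rw [response_inner_def]
    simp only [Finset.mul_sum]
    rw [Finset.sum_comm]
    refine Finset.sum_eq_zero fun k _ => ?_
    rw [← Finset.sum_fiberwise (s := Finset.univ)
      (g := fun (ξ : Scenario Ξ) (j : {j // j < k}) => ξ j)]
    refine Finset.sum_eq_zero fun h _ => ?_
    rcases Finset.eq_empty_or_nonempty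
      (Finset.univ.filter fun ξ : Scenario Ξ => (fun j : {j // j < k} => ξ j) = h) with he | ⟨ξ, hξ⟩
    · rw [he, Finset.sum_empty]
    · have hξ : (fun j : {j // j < k} => ξ j) = h := by simpa using hξ
      subst hξ
      have hs := (historyExpectation_eq_zero_iff P k _ ξ).1 (hw k ξ)
      have hf : (Finset.univ.filter fun η : Scenario Ξ =>
          (fun j : {j // j < k} => η j) = fun j : {j // j < k} => ξ j)
          = Finset.univ.filter fun η : Scenario Ξ => ∀ j < k, η j = ξ j := by
        ext η
        simp [funext_iff]
      rw [hf]
      calc _ = ∑ η with ∀ j < k, η j = ξ j,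
            inner ℝ (stagePart k (x ξ)) (P.prob η • stagePart k (w η)) := by
            refine Finset.sum_congr rfl fun η hη => ?_
            rw [hx k η ξ (by simpa using hη), real_inner_smul_right]
        _ = 0 := by rw [← inner_sum, hs, inner_zero_right]
  · intro hw k ξ
    rw [historyExpectation_eq_zero_iff]
    set S := ∑ η with ∀ j < k, η j = ξ j, P.prob η • stagePart k (w η) with hS
    let x : ResponseSpace P d := fun η => WithLp.toLp 2 fun q : (k : Fin N) × Fin (d k) =>
      if h : q.1 = k then (if ∀ j < k, η j = ξ j then S (h ▸ q.2) else 0) else 0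
    have hxk : ∀ η, stagePart k (x η) = if ∀ j < k, η j = ξ j then S else 0 := by
      intro η
      ext i
      rw [stagePart_apply]
      by_cases hη : ∀ j < k, η j = ξ j
      · simp only [x, dite_true, if_pos hη]
      · simp only [x, dite_true, if_neg hη]
        rfl
    have hxl : ∀ l, l ≠ k → ∀ η, stagePart l (x η) = 0 := by
      intro l hl η
      ext i
      rw [stagePart_apply]
      simp [x, hl]
    have hx : x ∈ nonanticipative P d := by
      intro l η ζ hηζ
      by_cases hl : l = k
      · subst hl
        rw [hxk, hxk]
        have : (∀ j < l, η j = ξ j) ↔ ∀ j < l, ζ j = ξ j :=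
          forall₂_congr fun j hj => by rw [hηζ j hj]
        simp only [this]
      · rw [hxl l hl, hxl l hl]
    have h0 := hw x hx
    rw [response_inner_def] at h0
    have h1 : inner ℝ S S = 0 := by
      rw [← h0]
      conv_lhs => rw [hS, inner_sum]
      rw [Finset.sum_filter]
      refine Finset.sum_congr rfl fun η _ => ?_
      rw [Finset.sum_eq_single k (fun l _ hl => by rw [hxl l hl, inner_zero_left]) (by simp), hxk]
      split_ifs
      · rw [real_inner_smul_right]
      · simp
    exact inner_self_eq_zero.1 h1

/-- The constraint set `𝓒 = {x | x(ξ) ∈ C(ξ) for all ξ}`. -/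
def constraintSet (P : ScenarioLaw Ξ) {d : Fin N → ℕ} (C : Scenario Ξ → Set (DecisionSpace d)) :
    Set (ResponseSpace P d) :=
  {x | ∀ ξ, x ξ ∈ C ξ}

/-- The mapping `𝓕(x) : ξ ↦ F(x(ξ), ξ)` on `𝓛_n`. -/
def responseMap (P : ScenarioLaw Ξ) {d : Fin N → ℕ}
    (F : DecisionSpace d → Scenario Ξ → DecisionSpace d) (x : ResponseSpace P d) :
    ResponseSpace P d :=
  fun ξ => F (x ξ) ξ

/-- The isometric isomorphism `φ : 𝓛_n → ℝ^{n̄}`, stacking the blocks `√p(ξ) x(ξ)`. -/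
def stack (P : ScenarioLaw Ξ) (d : Fin N → ℕ) : ResponseSpace P d ≃ₗᵢ[ℝ] StackedSpace Ξ d :=
  LinearEquiv.isometryOfInner
    { toFun := fun x => WithLp.toLp 2 fun q => √(P.prob q.1) * x q.1 q.2
      invFun := fun y ξ => WithLp.toLp 2 fun i => (√(P.prob ξ))⁻¹ * y (ξ, i)
      map_add' := fun x y => by
        ext q
        exact mul_add _ (x q.1 q.2) (y q.1 q.2)
      map_smul' := fun c x => by
        ext q
        exact mul_left_comm _ c (x q.1 q.2)
      left_inv := fun x => by
        funext ξ
        ext i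
        have := (Real.sqrt_pos.2 (P.prob_pos ξ)).ne'
        simp [this]
      right_inv := fun y => by
        ext q
        have := (Real.sqrt_pos.2 (P.prob_pos q.1)).ne'
        simp [this] }
    (fun x y => by
      rw [response_inner_def, PiLp.inner_apply, Fintype.sum_prod_type]
      refine Finset.sum_congr rfl fun ξ _ => ?_
      rw [inner_decision_eq_sum, PiLp.inner_apply, Finset.mul_sum]
      refine Finset.sum_congr rfl fun i _ => ?_
      have := Real.mul_self_sqrt (P.prob_pos ξ).le
      change (√(P.prob ξ) * y ξ i) * (√(P.prob ξ) * x ξ i) = P.prob ξ * (y ξ i * x ξ i)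
      linear_combination (x ξ i * y ξ i) * this)

/-- The block of `x ∈ ℝ^{n̄}` that belongs to the scenario `ξ`. -/
def scenarioBlock {d : Fin N → ℕ} (x : StackedSpace Ξ d) (ξ : Scenario Ξ) : DecisionSpace d :=
  WithLp.toLp 2 fun i => x (ξ, i)

/-- The mapping `F̂ : ℝ^{n̄} → ℝ^{n̄}` with blocks `√p(ξ) F(x_ξ / √p(ξ), ξ)`. -/
def stackedMap (P : ScenarioLaw Ξ) {d : Fin N → ℕ}
    (F : DecisionSpace d → Scenario Ξ → DecisionSpace d) (x : StackedSpace Ξ d) :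
    StackedSpace Ξ d :=
  WithLp.toLp 2 fun q =>
    √(P.prob q.1) * F ((1 / √(P.prob q.1)) • scenarioBlock x q.1) q.1 q.2

theorem stack_responseMap (P : ScenarioLaw Ξ) {d : Fin N → ℕ}
    (F : DecisionSpace d → Scenario Ξ → DecisionSpace d) (x : ResponseSpace P d) :
    stack P d (responseMap P F x) = stackedMap P F (stack P d x) := by
  ext q
  have h : (1 / √(P.prob q.1)) • scenarioBlock (stack P d x) q.1 = x q.1 := by
    ext i
    have := (Real.sqrt_pos.2 (P.prob_pos q.1)).ne'
    change (1 / √(P.prob q.1)) * (√(P.prob q.1) * x q.1 i) = x q.1 i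
    field_simp
  change _ = √(P.prob q.1) * F ((1 / √(P.prob q.1)) • scenarioBlock (stack P d x) q.1) q.1 q.2
  rw [h]
  rfl

/-- The orthogonal projection `P_{φ(𝓜_n)}` of `ℝ^{n̄}`. -/
def stackedMultiplierProj (P : ScenarioLaw Ξ) (d : Fin N → ℕ) :
    StackedSpace Ξ d →L[ℝ] StackedSpace Ξ d :=
  ((multiplierSpace P d).map (stack P d).toLinearEquiv.toLinearMap).starProjection

end Setting

end

/-! ### Monotonicity from the Jacobian. -/

section Monotonicity

open Filter Topology

variable {H : Type*} [NormedAddCommGroup H] [InnerProductSpace ℝ H]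

/-! It suffices that `G = F + s P_M` is monotone on the open convex set: `G` is continuous on the
nonempty closed convex constraint set, so adding the normal cone then gives a maximal monotone map
(`isMaximalMonotoneMap_add_normalConeAt`). By differentiation along segments, monotonicity of `G`
follows once its Jacobian has a nonnegative quadratic form.

Pseudomonotonicity alone gives `⟨v, DF(x) v⟩ ≥ 0` only for `v` orthogonal to `F x`, a subspace of
codimension at most one. Adding `e P_M` keeps this. A symmetric operator that is nonnegative on such
a subspace can be negative in at most one eigendirection; if its smallest eigenvalue is multiple,
the eigenspace meets the subspace nontrivially, so that eigenvalue is nonnegative and the operator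
is positive semidefinite (`LinearMap.IsSymmetric.inner_apply_nonneg_of_multiple_min`). Raising `e`
to `s` only adds a positive semidefinite term. -/

theorem hasDerivAt_inner_line {F : H → H} {x v : H} {t : ℝ}
    (hF : DifferentiableAt ℝ F (x + t • v)) :
    HasDerivAt (fun r : ℝ => inner ℝ v (F (x + r • v)))
      (inner ℝ v (fderiv ℝ F (x + t • v) v)) t := by
  have hl : HasDerivAt (fun r : ℝ => x + r • v) v t := by
    simpa using ((hasDerivAt_id t).smul_const v).const_add x
  have h := (hF.hasFDerivAt.comp_hasDerivAt t hl)
  exact (innerSL ℝ v).hasFDerivAt.comp_hasDerivAt t h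

/-- First-order necessary condition for pseudomonotonicity. -/
theorem PseudomonotoneOn.inner_fderiv_nonneg {F : H → H} {K : Set H}
    (hF : PseudomonotoneOn F K) (hK : IsOpen K) {x v : H} (hx : x ∈ K)
    (hd : DifferentiableAt ℝ F x) (hv : inner ℝ v (F x) = 0) :
    0 ≤ inner ℝ v (fderiv ℝ F x v) := by
  have hderiv := hasDerivAt_inner_line (F := F) (x := x) (v := v) (t := 0) (by simpa using hd)
  simp only [zero_smul, add_zero] at hderiv
  have hslope := hderiv.tendsto_slope_zero_right
  refine ge_of_tendsto hslope ?_
  have hcont : Tendsto (fun t : ℝ => x + t • v) (𝓝[>] 0) (𝓝 x) := by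
    have : Continuous fun t : ℝ => x + t • v := by fun_prop
    simpa using (this.tendsto 0).mono_left nhdsWithin_le_nhds
  filter_upwards [hcont (hK.mem_nhds hx), self_mem_nhdsWithin] with t ht ht0
  have ht0 : 0 < t := ht0
  -- The premise of pseudomonotonicity holds with equality because `v` is orthogonal to `F x`. As
  -- the value at `t = 0` vanishes too, the right difference quotients are nonnegative.
  have h := hF x hx _ ht (by simp [real_inner_smul_left, hv])
  rw [add_sub_cancel_left, real_inner_smul_left] at h
  have h := nonneg_of_mul_nonneg_right h ht0
  simp only [zero_add, zero_smul, add_zero, hv, sub_zero, smul_eq_mul]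
  positivity

/-- The function `t ↦ ⟨x - y, F (y + t (x - y))⟩` has the quadratic form of the Jacobian as
derivative, hence is nondecreasing on `[0, 1]`; compare its endpoints. -/
theorem inner_sub_nonneg_of_fderiv {F : H → H} {K : Set H} (hK : Convex ℝ K)
    (hd : ∀ x ∈ K, DifferentiableAt ℝ F x)
    (hF : ∀ x ∈ K, ∀ v, 0 ≤ inner ℝ v (fderiv ℝ F x v)) {x y : H} (hx : x ∈ K) (hy : y ∈ K) :
    0 ≤ inner ℝ (x - y) (F x - F y) := by
  have hmem : ∀ t ∈ Set.Icc (0 : ℝ) 1, y + t • (x - y) ∈ K := fun t ht =>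
    hK.add_smul_sub_mem hy hx ht
  have hder : ∀ t ∈ Set.Icc (0 : ℝ) 1, _ := fun t ht => hasDerivAt_inner_line (hd _ (hmem t ht))
  have hmono := monotoneOn_of_deriv_nonneg (convex_Icc (0 : ℝ) 1)
    (fun t ht => (hder t ht).continuousAt.continuousWithinAt)
    (fun t ht => (hder t (interior_subset ht)).differentiableAt.differentiableWithinAt)
    (fun t ht => by
      rw [(hder t (interior_subset ht)).deriv]
      exact hF _ (hmem t (interior_subset ht)) _)
  have h := hmono (Set.left_mem_Icc.2 zero_le_one) (Set.right_mem_Icc.2 zero_le_one) zero_le_one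
  simp only [zero_smul, add_zero, one_smul, add_sub_cancel] at h
  rw [inner_sub_right]
  linarith

/-! ### Spectral criteria for positive semidefiniteness. -/

theorem LinearMap.IsSymmetric.inner_apply_nonneg_of_eigenvalues [FiniteDimensional ℝ H]
    {A : H →ₗ[ℝ] H} (hA : A.IsSymmetric)
    (h : ∀ l : ℝ, Module.End.HasEigenvalue A l → 0 ≤ l) (v : H) : 0 ≤ inner ℝ v (A v) := by
  rw [← (hA.eigenvectorBasis rfl).sum_inner_mul_inner v (A v)]
  refine Finset.sum_nonneg fun i _ => ?_
  rw [← OrthonormalBasis.repr_apply_apply, hA.eigenvectorBasis_apply_self_apply,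
    OrthonormalBasis.repr_apply_apply, real_inner_comm v]
  have : 0 ≤ hA.eigenvalues rfl i := h _ (hA.hasEigenvalue_eigenvalues rfl i)
  rw [mul_left_comm]
  exact mul_nonneg this (mul_self_nonneg _)

/-- A symmetric operator that is nonnegative on a hyperplane and whose smallest eigenvalue is
multiple is positive semidefinite. -/
theorem LinearMap.IsSymmetric.inner_apply_nonneg_of_multiple_min [FiniteDimensional ℝ H]
    {A : H →ₗ[ℝ] H} (hA : A.IsSymmetric) (hm : HasMultipleMinEigenvalue A) (z : H)
    (hz : ∀ w, inner ℝ w z = 0 → 0 ≤ inner ℝ w (A w)) (v : H) : 0 ≤ inner ℝ v (A v) := by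
  obtain ⟨μ, hμ, hrank⟩ := hm
  -- A linear functional on a space of dimension at least two has a nonzero kernel vector: an
  -- eigenvector for `μ` orthogonal to `z`. The case `z = 0` needs no separate treatment.
  have hker := LinearMap.ker_ne_bot_of_finrank_lt
    (f := (innerₗ H z).domRestrict (Module.End.eigenspace A μ))
    (by rwa [Module.finrank_self])
  obtain ⟨⟨w, hwA⟩, hwz, hw0⟩ := (Submodule.ne_bot_iff _).1 hker
  have hw0 : w ≠ 0 := fun h => hw0 (Subtype.ext h)
  have hwz : inner ℝ z w = 0 := hwz
  have hpos := hz w (by rwa [real_inner_comm])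
  rw [Module.End.mem_eigenspace_iff.1 hwA, real_inner_smul_right] at hpos
  have hμ0 : 0 ≤ μ := nonneg_of_mul_nonneg_left hpos (real_inner_self_pos.2 hw0)
  exact hA.inner_apply_nonneg_of_eigenvalues (fun l hl => hμ0.trans (hμ.2 hl)) v

theorem inner_starProjection_self_nonneg (M : Submodule ℝ H) [M.HasOrthogonalProjection] (v : H) :
    0 ≤ inner ℝ v (M.starProjection v) := by
  rw [← M.inner_starProjection_left_eq_right]
  exact M.re_inner_starProjection_nonneg v

/-- Pseudomonotonicity, symmetric Jacobians and multiplicity of the smallest eigenvalue of the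
shifted Jacobians make the shifted mapping monotone. -/
theorem PseudomonotoneOn.monotone_add_smul_starProjection [FiniteDimensional ℝ H]
    {F : H → H} {K : Set H} (hF : PseudomonotoneOn F K) (hK : IsOpen K) (hKc : Convex ℝ K)
    (hd : ∀ x ∈ K, DifferentiableAt ℝ F x) (M : Submodule ℝ H)
    (hsymm : ∀ x ∈ K, (fderiv ℝ F x : H →ₗ[ℝ] H).IsSymmetric) {e s : ℝ} (he : 0 < e)
    (hm : ∀ x ∈ K, HasMultipleMinEigenvalue
      ((fderiv ℝ F x + e • M.starProjection : H →L[ℝ] H) : H →ₗ[ℝ] H))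
    (hs : e ≤ s) {x y : H} (hx : x ∈ K) (hy : y ∈ K) :
    0 ≤ inner ℝ (x - y) ((F x + s • M.starProjection x) - (F y + s • M.starProjection y)) := by
  have hder : ∀ z ∈ K, HasFDerivAt (fun z => F z + s • M.starProjection z)
      (fderiv ℝ F z + s • M.starProjection) z := fun z hz =>
    (hd z hz).hasFDerivAt.add (M.starProjection.hasFDerivAt.const_smul s)
  refine inner_sub_nonneg_of_fderiv hKc (fun z hz => (hder z hz).differentiableAt)
    (fun z hz v => ?_) hx hy
  rw [(hder z hz).fderiv]
  have hsym : ((fderiv ℝ F z + e • M.starProjection : H →L[ℝ] H) : H →ₗ[ℝ] H).IsSymmetric := by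
    intro a b
    have h1 := hsymm z hz a b
    have h2 := M.inner_starProjection_left_eq_right a b
    simp only [ContinuousLinearMap.coe_coe] at h1
    simp [inner_add_left, inner_add_right, real_inner_smul_left, real_inner_smul_right, h1, h2]
  have hpos := hsym.inner_apply_nonneg_of_multiple_min (hm z hz) (F z) (fun w hw => by
    have h1 := hF.inner_fderiv_nonneg hK hz (hd z hz) hw
    have h2 := mul_nonneg he.le (inner_starProjection_self_nonneg M w)
    simp only [ContinuousLinearMap.coe_coe, add_apply,
      smul_apply, inner_add_right, real_inner_smul_right]
    linarith) v
  -- Write `s = e + (s - e)`; the surplus multiple of the projection is positive semidefinite.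
  have h3 := mul_nonneg (sub_nonneg.2 hs) (inner_starProjection_self_nonneg M v)
  simp only [ContinuousLinearMap.coe_coe, add_apply,
    smul_apply, inner_add_right, real_inner_smul_right] at hpos ⊢
  linarith

/-- A mapping that is monotone and continuous on a nonempty closed convex set becomes maximal
monotone when the normal cone of the set is added. -/
theorem isMaximalMonotoneMap_add_normalConeAt [CompleteSpace H] {G : H → H} {C : Set H}
    (hne : C.Nonempty) (hcl : IsClosed C) (hcv : Convex ℝ C) (hG : ContinuousOn G C)
    (hmono : ∀ x ∈ C, ∀ y ∈ C, 0 ≤ inner ℝ (x - y) (G x - G y)) :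
    IsMaximalMonotoneMap fun x => {z | ∃ v ∈ normalConeAt C x, z = G x + v} := by
  refine ⟨?_, fun x y hxy => ?_⟩
  · rintro x y _ ⟨v, ⟨hx, hv⟩, rfl⟩ _ ⟨w, ⟨hy, hw⟩, rfl⟩
    have h1 := hmono x hx y hy
    have h2 := hv y hy
    have h3 := hw x hx
    rw [real_inner_comm] at h1
    simp only [inner_sub_left, inner_sub_right, inner_add_left] at *
    linarith
  · by_contra! hcon
    have hrel : ∀ x' ∈ C, ∀ v ∈ normalConeAt C x', 0 ≤ inner ℝ (y - (G x' + v)) (x - x') :=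
      fun x' _ v hv => hcon x' _ ⟨v, hv, rfl⟩
    have hxC : x ∈ C := by
      -- If `x ∉ C` has nearest point `p`, every `n (x - p)` is normal to `C` at `p`. Testing
      -- against these forces `n ‖x - p‖² ≤ ⟨y - G p, x - p⟩` for all `n`, which is impossible.
      obtain ⟨p, hp, hmin⟩ := exists_norm_eq_iInf_of_complete_convex hne hcl.isComplete hcv x
      have hnorm := (norm_eq_iInf_iff_real_inner_le_zero hcv hp).1 hmin
      by_contra hx
      have hxp : 0 < inner ℝ (x - p) (x - p) :=
        real_inner_self_pos.2 (sub_ne_zero.2 fun h => hx (h ▸ hp))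
      obtain ⟨n, hn⟩ := exists_nat_gt (inner ℝ (y - G p) (x - p) / inner ℝ (x - p) (x - p))
      rw [div_lt_iff₀ hxp] at hn
      have h := hrel p hp ((n : ℝ) • (x - p)) ⟨hp, fun z hz => by
        rw [real_inner_smul_left]
        exact mul_nonpos_of_nonneg_of_nonpos n.cast_nonneg (hnorm z hz)⟩
      rw [← sub_sub, inner_sub_left, real_inner_smul_left] at h
      linarith
    -- Minty's argument: test with the zero normal vector at `x + t (z - x)`, divide by `-t`, and
    -- let `t → 0⁺` using continuity of `G` on `C`.
    refine hxy ⟨y - G x, ⟨hxC, fun z hz => ?_⟩, by abel⟩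
    have hmem : ∀ t ∈ Set.Icc (0 : ℝ) 1, x + t • (z - x) ∈ C := fun t ht =>
      hcv.add_smul_sub_mem hxC hz ht
    have hIoc : ∀ᶠ t : ℝ in 𝓝[>] 0, t ∈ Set.Ioc (0 : ℝ) 1 := Ioc_mem_nhdsGT one_pos
    have hcont : Tendsto (fun t : ℝ => x + t • (z - x)) (𝓝[>] 0) (𝓝[C] x) := by
      refine tendsto_nhdsWithin_iff.2 ⟨?_, hIoc.mono fun t ht => hmem t ⟨ht.1.le, ht.2⟩⟩
      have : Continuous fun t : ℝ => x + t • (z - x) := by fun_prop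
      simpa using (this.tendsto 0).mono_left nhdsWithin_le_nhds
    have hlim : Tendsto (fun t : ℝ => inner ℝ (y - G (x + t • (z - x))) (z - x)) (𝓝[>] 0)
        (𝓝 (inner ℝ (y - G x) (z - x))) :=
      (tendsto_const_nhds.sub ((hG x hxC).tendsto.comp hcont)).inner tendsto_const_nhds
    refine le_of_tendsto hlim (hIoc.mono fun t ht => ?_)
    have h := hrel _ (hmem t ⟨ht.1.le, ht.2⟩) 0 ⟨hmem t ⟨ht.1.le, ht.2⟩, by simp⟩
    rw [add_zero, sub_add_cancel_left, inner_neg_right, real_inner_smul_right] at h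
    by_contra! hlt
    linarith [mul_pos ht.1 hlt]

/-! ### Transport along a linear isometry. -/

theorem PseudomonotoneOn.image_linearIsometryEquiv {E : Type*} [NormedAddCommGroup E]
    [InnerProductSpace ℝ E] (φ : H ≃ₗᵢ[ℝ] E) {F : H → H} {G : E → E}
    (hFG : ∀ x, φ (F x) = G (φ x)) {K : Set H} (hF : PseudomonotoneOn F K) :
    PseudomonotoneOn G (φ '' K) := by
  rintro _ ⟨x, hx, rfl⟩ _ ⟨y, hy, rfl⟩
  simpa only [← hFG, ← map_sub, LinearIsometryEquiv.inner_map_map] using hF x hx y hy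

theorem DifferentiableAt.conj_linearIsometryEquiv {E : Type*} [NormedAddCommGroup E]
    [InnerProductSpace ℝ E] (φ : H ≃ₗᵢ[ℝ] E) {F : H → H} {G : E → E}
    (hFG : ∀ x, φ (F x) = G (φ x)) {x : H} (hF : DifferentiableAt ℝ F x) :
    DifferentiableAt ℝ G (φ x) := by
  have hG : G = φ ∘ F ∘ φ.symm := by
    funext y
    simp [hFG]
  rw [hG]
  refine φ.differentiableAt.comp _ (DifferentiableAt.comp _ ?_ φ.symm.differentiableAt)
  simpa using hF

end Monotonicity

/-! ### The constraint set and the projection in the stochastic setting. -/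

section Constraints

variable {N : ℕ} {Ξ : Fin N → Type*} [∀ k, Fintype (Ξ k)] (P : ScenarioLaw Ξ) {d : Fin N → ℕ}
  {C : Scenario Ξ → Set (DecisionSpace d)}

theorem constraintSet_nonempty (h : ∀ ξ, (C ξ).Nonempty) : (constraintSet P C).Nonempty :=
  ⟨fun ξ => (h ξ).some, fun ξ => (h ξ).some_mem⟩

theorem constraintSet_convex (h : ∀ ξ, Convex ℝ (C ξ)) : Convex ℝ (constraintSet P C) :=
  fun _ hx _ hy _ _ ha hb hab ξ => h ξ (hx ξ) (hy ξ) ha hb hab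

theorem constraintSet_isClosed (h : ∀ ξ, IsClosed (C ξ)) : IsClosed (constraintSet P C) := by
  -- The topology comes from the weighted inner product, not from the product, so continuity of
  -- evaluation is obtained from finite dimensionality.
  have hcont : ∀ ξ, Continuous fun x : ResponseSpace P d => x ξ := fun ξ =>
    LinearMap.continuous_of_finiteDimensional
      ({ toFun := fun x => x ξ, map_add' := fun _ _ => rfl, map_smul' := fun _ _ => rfl } :
        ResponseSpace P d →ₗ[ℝ] DecisionSpace d)
  have : constraintSet P C = ⋂ ξ, (fun x : ResponseSpace P d => x ξ) ⁻¹' C ξ := by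
    ext x
    simp [constraintSet]
  rw [this]
  exact isClosed_iInter fun ξ => (h ξ).preimage (hcont ξ)

theorem stack_starProjection_multiplierSpace (x : ResponseSpace P d) :
    stack P d ((multiplierSpace P d).starProjection x) =
      stackedMultiplierProj P d (stack P d x) := by
  rw [stackedMultiplierProj]
  have h := Submodule.starProjection_map_apply (stack P d) (multiplierSpace P d) (stack P d x)
  rw [LinearIsometryEquiv.symm_apply_apply] at h
  exact h.symm

end Constraints

theorem mainTheorem7 {N : ℕ} {Ξ : Fin N → Type*} [∀ k, Fintype (Ξ k)] (P : ScenarioLaw Ξ)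
    (d : Fin N → ℕ)
    (C : Scenario Ξ → Set (DecisionSpace d))
    (hC_nonempty : ∀ ξ, (C ξ).Nonempty)
    (hC_closed : ∀ ξ, IsClosed (C ξ))
    (hC_convex : ∀ ξ, Convex ℝ (C ξ))
    (F : DecisionSpace d → Scenario Ξ → DecisionSpace d)
    (C₀ : Set (ResponseSpace P d))
    (hC₀_open : IsOpen C₀)
    (hC₀_convex : Convex ℝ C₀)
    (hC₀_sup : constraintSet P C ⊆ C₀)
    (hF_smooth : ContDiffOn ℝ 1 (responseMap P F) C₀)
    (hF_pseudo : PseudomonotoneOn (responseMap P F) C₀)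
    (hF_symm : ∀ x ∈ stack P d '' C₀,
      (fderiv ℝ (stackedMap P F) x : StackedSpace Ξ d →ₗ[ℝ] StackedSpace Ξ d).IsSymmetric)
    (e₂ : ℝ) (he₂ : 0 < e₂)
    (he₂_mult : ∀ x ∈ stack P d '' C₀,
      HasMultipleMinEigenvalue
        ((fderiv ℝ (stackedMap P F) x + e₂ • stackedMultiplierProj P d :
          StackedSpace Ξ d →L[ℝ] StackedSpace Ξ d) : StackedSpace Ξ d →ₗ[ℝ] StackedSpace Ξ d)) :
    ∀ s : ℝ, e₂ ≤ s →
      IsElicitedAtLevel (responseMap P F) (constraintSet P C) (multiplierSpace P d) s := by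
  intro s hs
  have hdiff : ∀ x ∈ C₀, DifferentiableAt ℝ (responseMap P F) x := fun x hx =>
    ((hF_smooth x hx).contDiffAt (hC₀_open.mem_nhds hx)).differentiableAt one_ne_zero
  have hmono : ∀ x ∈ C₀, ∀ y ∈ C₀, 0 ≤ inner ℝ (x - y)
      ((responseMap P F x + s • (multiplierSpace P d).starProjection x) -
        (responseMap P F y + s • (multiplierSpace P d).starProjection y)) := by
    intro x hx y hy
    -- The Jacobian hypotheses live on the stacked space, so monotonicity is proved there on `φ(C₀)`
    -- and pulled back through the isometry.
    have h := (hF_pseudo.image_linearIsometryEquiv (stack P d)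
      (stack_responseMap P F)).monotone_add_smul_starProjection
      ((stack P d).toHomeomorph.isOpenMap _ hC₀_open)
      (hC₀_convex.linear_image (stack P d).toLinearEquiv.toLinearMap)
      (by
        rintro _ ⟨z, hz, rfl⟩
        exact (hdiff z hz).conj_linearIsometryEquiv (stack P d) (stack_responseMap P F))
      ((multiplierSpace P d).map (stack P d).toLinearEquiv.toLinearMap)
      hF_symm he₂ he₂_mult hs ⟨x, hx, rfl⟩ ⟨y, hy, rfl⟩
    rw [← stackedMultiplierProj] at h
    rwa [← stack_starProjection_multiplierSpace, ← stack_starProjection_multiplierSpace,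
      ← stack_responseMap, ← stack_responseMap, ← (stack P d).map_smul, ← (stack P d).map_smul,
      ← map_add, ← map_add, ← map_sub, ← map_sub, LinearIsometryEquiv.inner_map_map] at h
  refine ⟨he₂.trans_le hs, ?_⟩
  have hcont : ContinuousOn
      (fun x => responseMap P F x + s • (multiplierSpace P d).starProjection x)
      (constraintSet P C) :=
    (hF_smooth.continuousOn.mono hC₀_sup).add
      ((multiplierSpace P d).starProjection.continuous.const_smul s).continuousOn
  have hmax := isMaximalMonotoneMap_add_normalConeAt (constraintSet_nonempty P hC_nonempty)
    (constraintSet_isClosed P hC_closed) (constraintSet_convex P hC_convex) hcont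
    fun x hx y hy => hmono x (hC₀_sup hx) y (hC₀_sup hy)
  convert hmax using 1
  funext x
  simp only [elicitationMap, add_right_comm]
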